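/- **Setting.** Let $\mathcal U$ be a set of input items. A minimization problem $B$ over $\mathcal U$ is given by a collection of finite subsets of $\mathcal U$, its instances, and, for each instance $I$ and each $S\subseteq I$, a cost $\mathrm{cost}(I,S)\in[0,\infty]$ of the solution that accepts exactly the items in $S$ and rejects those in $I\setminus S$ ($\infty$ means infeasible). Put $\mathrm{OPT}(I)=\min_{S\subseteq I}\mathrm{cost}(I,S)$. The objective is *additive* if for all disjoint instances $I_1,I_2$ such that $I_1\cup I_2$ is an instance, $\mathrm{OPT}(I_1\cup I_2)=\mathrm{OPT}(I_1)+\mathrm{OPT}(I_2)$ and $\mathrm{cost}(I_1\cup I_2,S_1\cup S_2)\ge \mathrm{cost}(I_1,S_1)+\mathrm{cost}(I_2,S_2)$ for all $S_1\subseteq I_1$, $S_2\subseteq I_2$. A *fixed priority algorithm with advice* has an injective priority function $P:\mathcal U\to\mathbb R$. The items of an instance $I$ arrive in order of decreasing priority, and each is irrevocably accepted or rejected, deterministically, on the basis of the items seen so far and of an infinite tape of advice bits prepared by an oracle that knows $I$. It *reads fewer than $\beta(n)$ advice bits* if, for all sufficiently large $n$, on every instance with $n$ items its answers depend only on some initial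 segment of fewer than $\beta(n)$ bits of the tape. Writing $\mathrm{ALG}(I)$ for the cost that it obtains on $I$, its (asymptotic) *approximation ratio* is the infimum of all $c\ge 0$ for which there is a constant $\alpha$ with $\mathrm{ALG}(I)\le c\,\mathrm{OPT}(I)+\alpha$ for all instances $I$ ($\infty$ if there is no such $c$). For a gadget (an instance) $G$ with highest-priority item $m$, $\mathrm{BAD}(G)$ is the minimum cost of a solution of $G$ that makes the wrong decision on $m$: the one that rejects $m$ if some optimal solution accepts $m$, and otherwise the one that accepts $m$. Let $H(p)=-p\log_2p-(1-p)\log_2(1-p)$. **Theorem.** Let $B$ be a minimization problem with an additive objective and let $\mathrm{ALG}$ be a fixed priority algorithm with advice for $B$, with priority function $P$. Suppose that for each $x\in\mathbb Q\cap[0,\tfrac12]$ there is a pair of gadgets $(G_x^1,G_x^2)$ such that 1. (first item) $G_x^1$ and $G_x^2$ have the same highest-priority item $m_1(x)$ with respect to $P$; 2. (distinguishing decision) all optimal solutions of $G_x^1$ make the same decision on $m_1(x)$, and all optimal solutions of $G_x^2$ make the opposite decision; 3. (size) all gadgets have at most $s$ items; 4. (disjoint copies) for $x\ne y$ and $i,j\in\{1,2\}$,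 $G_x^i\cap G_y^j=\emptyset$, and every union of finitely many (at least one) gadgets belonging to distinct values of $x$ is an instance of $B$; 5. (OPT and BAD) $\mathrm{OPT}(G_x^i)=\mathrm{OPT}(G^i)$ and $\mathrm{BAD}(G_x^i)=\mathrm{BAD}(G^i)$ do not depend on $x$ ($i=1,2$), and $\mathrm{OPT}(G^2)\ge\mathrm{OPT}(G^1)$. Put $r=\min\left\{\frac{\mathrm{BAD}(G^1)}{\mathrm{OPT}(G^1)},\frac{\mathrm{BAD}(G^2)}{\mathrm{OPT}(G^2)}\right\}$. Let $\varepsilon\in(0,\tfrac12)$. If $\mathrm{ALG}$ reads fewer than $(1-H(\varepsilon))\,n/(2s)$ advice bits, then its approximation ratio is at least $$1+\frac{\varepsilon\,(r-1)\,\mathrm{OPT}(G^1)}{\varepsilon\,\mathrm{OPT}(G^1)+(1-\varepsilon)\,\mathrm{OPT}(G^2)}.$$ (Here $\mathrm{OPT}(G^i)<\infty$ and $\mathrm{OPT}(G^i)<\mathrm{BAD}(G^i)\le\infty$ by 2. Calculations are in $[0,\infty]$, with $a/0=\infty$ for $a>0$, $0\cdot\infty=0$ and $0/0=0$; if $\mathrm{OPT}(G^1)=0$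 the bound is $1$.) -/

import Mathlib

open scoped ENNReal NNReal

noncomputable section

/-- A minimization problem over the universe `U` of input items in which a solution is an
accept/reject decision for every item of the instance. `IsInstance I` is the consistency condition
on a finite set of items; `cost I S` is the value of the objective function on the instance `I` when
exactly the items of `S ⊆ I` are accepted (`∞` stands for an infeasible solution). -/
structure MinProblem (U : Type*) where
  IsInstance : Finset U → Prop
  cost : Finset U → Finset U → ℝ≥0∞

namespace MinProblem

variable {U : Type*} [DecidableEq U] (B : MinProblem U)

/-- `OPT(I)`: the best value of the objective function on `I`. -/
def opt (I : Finset U) : ℝ≥0∞ := ⨅ S ∈ I.powerset, B.cost I S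

/-- The set of accepted items `S` is an optimal solution of `I`. -/
def IsOptimal (I S : Finset U) : Prop := S ⊆ I ∧ B.cost I S = B.opt I

open Classical in
/-- `BAD(G)`, where `m` is the first item of `G`: if some optimal solution accepts `m`, the best
value given that `m` is rejected; otherwise the best value given that `m` is accepted. -/
def bad (G : Finset U) (m : U) : ℝ≥0∞ :=
  if ∃ S, B.IsOptimal G S ∧ m ∈ S then
    ⨅ S ∈ G.powerset.filter (fun S => m ∉ S), B.cost G S
  else
    ⨅ S ∈ G.powerset.filter (fun S => m ∈ S), B.cost G S

/-- The objective function is additive: on disjoint instances (whose union is an instance) the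
optimal values add up, and a solution of the union costs at least as much as its two parts cost
together. -/
def IsAdditive : Prop :=
  ∀ I J : Finset U, B.IsInstance I → B.IsInstance J → Disjoint I J → B.IsInstance (I ∪ J) →
    B.opt (I ∪ J) = B.opt I + B.opt J ∧
    ∀ S T : Finset U, S ⊆ I → T ⊆ J → B.cost I S + B.cost J T ≤ B.cost (I ∪ J) (S ∪ T)

/-- Every optimal solution of `G` takes the decision `a` (`true` is accept) on the item `m`. -/
def OptimalDecision (G : Finset U) (m : U) (a : Bool) : Prop :=
  ∀ S, B.IsOptimal G S → (m ∈ S ↔ a = true)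

end MinProblem

/-- A deterministic fixed priority algorithm with advice. Items of larger priority arrive earlier;
the order of arrival is total since `prio` is injective. The advice tape is written by an
oracle that sees the whole instance. `decision φ H u` is the answer (`true` is accept) to the item
`u` with tape `φ` when `H` is the set of items that have arrived before `u`; given the
priorities, `H` determines the sequence of these items, and with `φ` also the earlier answers. -/
structure PriorityAlgorithm (U : Type*) where
  prio : U → ℝ
  prio_injective : Function.Injective prio
  decision : (ℕ → Bool) → Finset U → U → Bool
  oracle : Finset U → ℕ → Bool

namespace PriorityAlgorithm

variable {U : Type*} [DecidableEq U] (A : PriorityAlgorithm U) (B : MinProblem U)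

/-- The answer to the item `u` of the instance `I` when the tape is `φ`. -/
def answer (φ : ℕ → Bool) (I : Finset U) (u : U) : Bool :=
  A.decision φ (I.filter (fun v => A.prio u < A.prio v)) u

/-- The set of items accepted on the instance `I`, with the tape written by the oracle. -/
def accepted (I : Finset U) : Finset U := I.filter (fun u => A.answer (A.oracle I) I u = true)

/-- `ALG(I)`: the objective value obtained on the instance `I`. -/
def algCost (I : Finset U) : ℝ≥0∞ := B.cost I (A.accepted I)

/-- On the instance `I` the algorithm uses at most the first `k` bits of its advice tape: whatever
stands on the tape after them, all answers are the same. -/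
def ReadsAtMost (I : Finset U) (k : ℕ) : Prop :=
  ∀ φ : ℕ → Bool, (∀ i < k, φ i = A.oracle I i) →
    ∀ u ∈ I, A.answer φ I u = A.answer (A.oracle I) I u

/-- On every instance with `n` items the algorithm reads fewer than `β n` advice bits, for all
large enough `n`. -/
def ReadsFewerThan (β : ℕ → ℝ) : Prop :=
  ∀ᶠ n in Filter.atTop, ∀ I : Finset U, B.IsInstance I → I.card = n →
    ∃ k : ℕ, (k : ℝ) < β n ∧ A.ReadsAtMost I k

/-- `ALG(I) ≤ c · OPT(I) + α` for all instances `I`, with a constant `α`. -/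
def IsApprox (c : ℝ≥0) : Prop :=
  ∃ α : ℝ≥0, ∀ I : Finset U, B.IsInstance I → A.algCost B I ≤ c * B.opt I + α

/-- The (asymptotic) approximation ratio: the infimum of all `c` such that the algorithm is a
`c`-approximation, and `∞` if there is none. -/
def approxRatio : ℝ≥0∞ := ⨅ (c : ℝ≥0) (_ : A.IsApprox B c), (c : ℝ≥0∞)

end PriorityAlgorithm

/-- `m` is the item of highest priority of `G`. -/
def IsFirstItem {U : Type*} (P : U → ℝ) (G : Finset U) (m : U) : Prop :=
  m ∈ G ∧ ∀ u ∈ G, P u ≤ P m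

/-- The binary entropy function, with logarithms to base 2. -/
def entropyTwo (p : ℝ) : ℝ := -p * Real.logb 2 p - (1 - p) * Real.logb 2 (1 - p)

/-- The rational numbers in `[0, 1/2]`. -/
abbrev HalfRat : Type := Set.Icc (0 : ℚ) (1 / 2)

/-- The conditions on gadget pairs `(G x 0, G x 1)`, one for every rational `x` in `[0, 1/2]`, with
first items `m x`, sizes at most `s`, and values `O i` of `OPT` and `D i` of `BAD`. -/
structure IsGadgetFamily {U : Type*} [DecidableEq U] (B : MinProblem U) (P : U → ℝ)
    (G : HalfRat → Fin 2 → Finset U) (m : HalfRat → U) (s : ℕ) (O D : Fin 2 → ℝ≥0∞) : Prop where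
  /-- Every nonempty union of gadgets that belong to different `x` is an instance; in particular
  every gadget is one. -/
  isInstance : ∀ (X : Finset HalfRat) (i : HalfRat → Fin 2), X.Nonempty →
    B.IsInstance (X.biUnion (fun x => G x (i x)))
  first_item : ∀ x i, IsFirstItem P (G x i) (m x)
  distinguishing : ∀ x, ∃ a b : Bool, a ≠ b ∧
    B.OptimalDecision (G x 0) (m x) a ∧ B.OptimalDecision (G x 1) (m x) b
  size : ∀ x i, (G x i).card ≤ s
  disjoint_copies : ∀ x y, x ≠ y → ∀ i j, Disjoint (G x i) (G y j)
  opt_eq : ∀ x i, B.opt (G x i) = O i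
  bad_eq : ∀ x i, B.bad (G x i) (m x) = D i
  opt_le : O 0 ≤ O 1

end

/-! Choose `N` values of `x`; each set `T` of them gives the instance that uses the second gadget
for `x ∈ T` and the first gadget otherwise. Deciding on the first items then amounts to guessing `T`
bit by bit. For a fixed tape, `T` is determined by the set of wrong guesses (`wrongAnswers_injOn`),
so at most `2 ^ (H(ε) N)` sets `T` lead to at most `ε N` errors (`card_powerset_filter_card_le`). An
instance has at most `s N` items, so only about `2 ^ ((1 - H(ε)) N / 2)` tapes matter, and for large
`N` some `T` forces more than `ε N` errors under all of them. The same count also leaves more than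
`ε N` first gadgets.

By additivity each error costs at least `δ`, the smaller of the two differences `BAD - OPT`, while
`OPT ≤ N Q` with `Q = ε OPT(G^1) + (1 - ε) OPT(G^2)`. Letting `N → ∞` gives `ε δ ≤ (c - 1) Q` for
every approximation factor `c`, and `(r - 1) OPT(G^1) ≤ δ`. -/

open scoped Finset

/-! ### Optimal and wrong decisions; additivity over finite unions. -/

namespace MinProblem

variable {U : Type*} (B : MinProblem U)

lemma opt_le_cost {I S : Finset U} (h : S ⊆ I) : B.opt I ≤ B.cost I S :=
  iInf₂_le S (Finset.mem_powerset.2 h)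

lemma exists_isOptimal (I : Finset U) : ∃ S, B.IsOptimal I S := by
  obtain ⟨S, hS, hmin⟩ := Finset.exists_min_image I.powerset (B.cost I)
    ⟨∅, Finset.empty_mem_powerset I⟩
  exact ⟨S, Finset.mem_powerset.1 hS,
    le_antisymm (le_iInf₂ hmin) (B.opt_le_cost (Finset.mem_powerset.1 hS))⟩

variable {B}

/-- With an infinite optimum every solution would be optimal, and `∅` and `{m}` disagree on `m`. -/
lemma OptimalDecision.opt_ne_top {I : Finset U} {m : U} {a : Bool}
    (h : B.OptimalDecision I m a) (hm : m ∈ I) : B.opt I ≠ ⊤ := by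
  intro htop
  have key : ∀ S ⊆ I, B.IsOptimal I S := fun S hS =>
    ⟨hS, by rw [htop]; exact top_le_iff.1 (htop ▸ B.opt_le_cost hS)⟩
  have h1 := h ∅ (key ∅ (Finset.empty_subset I))
  have h2 := h {m} (key {m} (Finset.singleton_subset_iff.2 hm))
  simp at h1 h2
  simp [h1] at h2

variable [DecidableEq U]

/-- If the optimal decision is unique, `BAD` is the best cost with the other decision. -/
lemma OptimalDecision.bad_eq {I : Finset U} {m : U} {a : Bool} (h : B.OptimalDecision I m a) :
    B.bad I m = ⨅ S ∈ I.powerset.filter (fun S => ¬(m ∈ S ↔ a = true)), B.cost I S := by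
  classical
  obtain ⟨S, hS⟩ := B.exists_isOptimal I
  unfold bad
  cases a with
  | true =>
    rw [if_pos ⟨S, hS, (h S hS).2 rfl⟩]
    simp
  | false =>
    rw [if_neg]
    · simp
    · rintro ⟨T, hT, hmT⟩
      simpa using (h T hT).1 hmT

lemma OptimalDecision.bad_le_cost {I S : Finset U} {m : U} {a : Bool}
    (h : B.OptimalDecision I m a) (hS : S ⊆ I) (hw : ¬(m ∈ S ↔ a = true)) :
    B.bad I m ≤ B.cost I S := by
  rw [h.bad_eq]
  exact iInf₂_le S (Finset.mem_filter.2 ⟨Finset.mem_powerset.2 hS, hw⟩)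

/-- The infimum runs over finitely many solutions, and one that attained the optimum would be an
optimal solution with the wrong decision. -/
lemma OptimalDecision.opt_lt_bad {I : Finset U} {m : U} {a : Bool}
    (h : B.OptimalDecision I m a) (hm : m ∈ I) : B.opt I < B.bad I m := by
  rw [h.bad_eq]
  set F := I.powerset.filter (fun S => ¬(m ∈ S ↔ a = true)) with hF
  rw [← Finset.inf_eq_iInf, Finset.lt_inf_iff (lt_top_iff_ne_top.2 (h.opt_ne_top hm))]
  intro S hS
  obtain ⟨hSI, hw⟩ := Finset.mem_filter.1 hS
  rw [Finset.mem_powerset] at hSI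
  refine lt_of_le_of_ne (B.opt_le_cost hSI) fun heq => hw (h S ⟨hSI, heq.symm⟩)

/-- An additive objective on the union of a finite disjoint family. -/
lemma IsAdditive.biUnion (hB : B.IsAdditive) {ι : Type*} [DecidableEq ι] (g : ι → Finset U)
    (hdisj : ∀ x y, x ≠ y → Disjoint (g x) (g y))
    (hinst : ∀ X : Finset ι, X.Nonempty → B.IsInstance (X.biUnion g))
    (X : Finset ι) (hX : X.Nonempty) :
    B.opt (X.biUnion g) = ∑ x ∈ X, B.opt (g x) ∧
    ∀ S ⊆ X.biUnion g, ∑ x ∈ X, B.cost (g x) (S ∩ g x) ≤ B.cost (X.biUnion g) S := by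
  induction hX using Finset.Nonempty.cons_induction with
  | singleton x =>
    simp only [Finset.singleton_biUnion, Finset.sum_singleton, true_and]
    intro S hS
    rw [Finset.inter_eq_left.2 hS]
  | cons x X hx hX ih =>
    have hu : (Finset.cons x X hx).biUnion g = g x ∪ X.biUnion g := by
      rw [Finset.cons_eq_insert, Finset.biUnion_insert]
    have hd : Disjoint (g x) (X.biUnion g) := by
      rw [Finset.disjoint_biUnion_right]
      exact fun y hy => hdisj x y fun h => hx (h ▸ hy)
    have hx1 : B.IsInstance (g x) := by simpa using hinst {x} (Finset.singleton_nonempty x)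
    have hadd := hB (g x) (X.biUnion g) hx1 (hinst X hX) hd
      (hu ▸ hinst _ (Finset.cons_nonempty hx))
    rw [hu]
    refine ⟨by rw [hadd.1, Finset.sum_cons, ih.1], fun S hS => ?_⟩
    have hSS : S = (S ∩ g x) ∪ (S ∩ X.biUnion g) := by
      rw [← Finset.inter_union_distrib_left, Finset.inter_eq_left.2 hS]
    have h1 := hadd.2 (S ∩ g x) (S ∩ X.biUnion g) Finset.inter_subset_right
      Finset.inter_subset_right
    rw [← hSS] at h1
    refine le_trans ?_ h1
    rw [Finset.sum_cons]
    gcongr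
    refine le_trans (le_of_eq (Finset.sum_congr rfl fun y hy => ?_))
      (ih.2 (S ∩ X.biUnion g) Finset.inter_subset_right)
    rw [Finset.inter_assoc, Finset.inter_eq_right.2 (Finset.subset_biUnion_of_mem g hy)]

end MinProblem

/-! ### Entropy bound for Hamming balls and the counting argument. -/

section Entropy

lemma entropyTwo_lt_one {ε : ℝ} (hε : ε ∈ Set.Ioo (0 : ℝ) (1 / 2)) : entropyTwo ε < 1 := by
  have h : entropyTwo ε = Real.binEntropy ε / Real.log 2 := by
    simp only [entropyTwo, Real.binEntropy_eq_negMulLog_add_negMulLog_one_sub, Real.negMulLog,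
      Real.logb]
    ring
  rw [h, div_lt_one (Real.log_pos one_lt_two), Real.binEntropy_lt_log_two]
  intro h
  have := hε.2
  norm_num [h] at this

lemma two_rpow_neg_entropyTwo_mul {ε : ℝ} (h0 : 0 < ε) (h1 : ε < 1) (n : ℝ) :
    (2 : ℝ) ^ (-(entropyTwo ε * n)) = ε ^ (ε * n) * (1 - ε) ^ ((1 - ε) * n) := by
  have h2 : 0 < 1 - ε := by linarith
  have e1 : ε ^ (ε * n) = (2 : ℝ) ^ (Real.logb 2 ε * (ε * n)) := by
    rw [Real.rpow_mul zero_le_two, Real.rpow_logb two_pos (by norm_num) h0]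
  have e2 : (1 - ε) ^ ((1 - ε) * n) = (2 : ℝ) ^ (Real.logb 2 (1 - ε) * ((1 - ε) * n)) := by
    rw [Real.rpow_mul zero_le_two, Real.rpow_logb two_pos (by norm_num) h2]
  rw [e1, e2, ← Real.rpow_add two_pos, entropyTwo]
  congr 1
  ring

/-- The Hamming ball of radius `ε n` has at most `2 ^ (H(ε) n)` elements. -/
lemma card_powerset_filter_card_le {ι : Type*} (X : Finset ι) {ε : ℝ}
    (hε : ε ∈ Set.Ioo (0 : ℝ) (1 / 2)) :
    (#(X.powerset.filter fun E => (#E : ℝ) ≤ ε * #X) : ℝ) ≤ 2 ^ (entropyTwo ε * #X) := by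
  obtain ⟨h0, hlt⟩ := hε
  have h1 : 0 < 1 - ε := by linarith
  -- These weights are the distribution of a random subset that contains each element independently
  -- with probability `ε`.
  have hsum : ∑ E ∈ X.powerset, ε ^ #E * (1 - ε) ^ (#X - #E) = 1 := by
    rw [Finset.sum_pow_mul_eq_add_pow]
    simp
  -- Since `ε ≤ 1 - ε`, the weight decreases with `#E`; its value at `#E = ε * #X` is a lower bound
  -- on the ball.
  have hterm : ∀ E ∈ X.powerset.filter fun E => (#E : ℝ) ≤ ε * #X,
      (2 : ℝ) ^ (-(entropyTwo ε * #X)) ≤ ε ^ #E * (1 - ε) ^ (#X - #E) := by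
    intro E hE
    obtain ⟨hEX, hle⟩ := Finset.mem_filter.1 hE
    have hcard := Finset.card_le_card (Finset.mem_powerset.1 hEX)
    rw [two_rpow_neg_entropyTwo_mul h0 (by linarith), ← Real.rpow_natCast, ← Real.rpow_natCast,
      Nat.cast_sub hcard]
    have hε' : ε * #X = #E + (ε * #X - #E) := by ring
    have h1' : (#X - #E : ℝ) = (1 - ε) * #X + (ε * #X - #E) := by ring
    rw [h1', hε', Real.rpow_add h0, Real.rpow_add h1, ← hε', mul_assoc,
      mul_comm ((1 - ε) ^ ((1 - ε) * (#X : ℝ)))]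
    gcongr
    linarith
  have hle : (#(X.powerset.filter fun E => (#E : ℝ) ≤ ε * #X) : ℝ) *
      2 ^ (-(entropyTwo ε * #X)) ≤ 1 := by
    rw [← hsum, ← nsmul_eq_mul, ← Finset.sum_const]
    refine (Finset.sum_le_sum hterm).trans
      (Finset.sum_le_sum_of_subset_of_nonneg (Finset.filter_subset _ _) fun E _ _ => ?_)
    positivity
  rwa [Real.rpow_neg zero_le_two, ← div_eq_mul_inv, div_le_one (by positivity)] at hle

/-- If each of at most `2 ^ k` injective encodings of the subsets of `X` covers only the subsets
with small code, then some subset has a large code for all encodings and a large complement. -/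
lemma exists_subset_large_code {ι κ : Type*} [DecidableEq ι] [Fintype κ] (X : Finset ι) {ε : ℝ}
    (hε : ε ∈ Set.Ioo (0 : ℝ) (1 / 2)) (code : κ → Finset ι → Finset ι)
    (hsub : ∀ t T, code t T ⊆ X)
    (hinj : ∀ t, Set.InjOn (code t) X.powerset)
    (hκ : (Fintype.card κ : ℝ) + 1 < 2 ^ ((1 - entropyTwo ε) * #X)) :
    ∃ T ⊆ X, (∀ t, ε * #X < #(code t T)) ∧ ε * #X < #(X \ T) := by
  set F := X.powerset.filter fun E => (#E : ℝ) ≤ ε * #X with hF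
  have hbound : ∀ c : Finset ι → Finset ι, (∀ T, c T ⊆ X) → Set.InjOn c X.powerset →
      #(X.powerset.filter fun T => (#(c T) : ℝ) ≤ ε * #X) ≤ #F := by
    intro c hc hi
    refine Finset.card_le_card_of_injOn c (fun T hT => ?_) (hi.mono ?_)
    · exact Finset.mem_filter.2 ⟨Finset.mem_powerset.2 (hc T), (Finset.mem_filter.1 hT).2⟩
    · exact fun T hT => (Finset.mem_filter.1 hT).1
  by_contra! hno
  have hcover : X.powerset ⊆
      (Finset.univ.biUnion fun t => X.powerset.filter fun T => (#(code t T) : ℝ) ≤ ε * #X) ∪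
        X.powerset.filter fun T => (#(X \ T) : ℝ) ≤ ε * #X := by
    intro T hT
    by_cases h : ∀ t, ε * #X < #(code t T)
    · exact Finset.mem_union_right _
        (Finset.mem_filter.2 ⟨hT, hno T (Finset.mem_powerset.1 hT) h⟩)
    · push Not at h
      obtain ⟨t, ht⟩ := h
      exact Finset.mem_union_left _
        (Finset.mem_biUnion.2 ⟨t, Finset.mem_univ t, Finset.mem_filter.2 ⟨hT, ht⟩⟩)
  -- Complementation is one more injective code, which accounts for the `+ 1` in `hκ`.
  have hcompl : Set.InjOn (fun T => X \ T) (X.powerset : Set (Finset ι)) := by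
    intro S hS T hT h
    have hS := Finset.mem_powerset.1 (Finset.mem_coe.1 hS)
    have hT := Finset.mem_powerset.1 (Finset.mem_coe.1 hT)
    rw [← Finset.sdiff_sdiff_eq_self hS, ← Finset.sdiff_sdiff_eq_self hT]
    exact congrArg (X \ ·) h
  have hcard : 2 ^ #X ≤ Fintype.card κ * #F + #F := by
    rw [← Finset.card_powerset]
    refine (Finset.card_le_card hcover).trans ((Finset.card_union_le _ _).trans ?_)
    refine add_le_add (Finset.card_biUnion_le.trans ?_)
      (hbound _ (fun T => Finset.sdiff_subset) hcompl)
    refine (Finset.sum_le_sum fun t _ => hbound (code t) (hsub t) (hinj t)).trans ?_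
    simp
  have hcard' : (2 : ℝ) ^ #X ≤ (Fintype.card κ + 1) * #F := by
    rw [add_mul, one_mul]
    exact_mod_cast hcard
  have hlt : ((Fintype.card κ : ℝ) + 1) * #F < 2 ^ #X := by
    calc ((Fintype.card κ : ℝ) + 1) * #F
        ≤ (Fintype.card κ + 1) * 2 ^ (entropyTwo ε * #X) := by
          gcongr
          exact card_powerset_filter_card_le X hε
      _ < 2 ^ ((1 - entropyTwo ε) * #X) * 2 ^ (entropyTwo ε * #X) := by gcongr
      _ = 2 ^ #X := by
          rw [← Real.rpow_add two_pos, ← Real.rpow_natCast]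
          congr 1
          ring
  linarith

end Entropy

/-! ### Unions of gadgets as a guessing game. -/

section Gadgets

variable {U : Type*} [DecidableEq U]

/-- The index of the gadget chosen for `x`, where `T` is the set of all `x` whose second gadget
is chosen. -/
def gadgetIndex (T : Finset HalfRat) (x : HalfRat) : Fin 2 := if x ∈ T then 1 else 0

/-- The union of the gadgets chosen by `T` for the elements of `X`. -/
def gadgetUnion (G : HalfRat → Fin 2 → Finset U) (X T : Finset HalfRat) : Finset U :=
  X.biUnion fun x => G x (gadgetIndex T x)

/-- The elements `x` of `X` for which the answer to the item `m x` is wrong, where `d x i` is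
the optimal decision on `m x` in the gadget `G x i`. -/
noncomputable def wrongAnswers (A : PriorityAlgorithm U) (G : HalfRat → Fin 2 → Finset U) (m : HalfRat → U)
    (d : HalfRat → Fin 2 → Bool) (X : Finset HalfRat) (φ : ℕ → Bool) (T : Finset HalfRat) :
    Finset HalfRat :=
  X.filter fun x => A.answer φ (gadgetUnion G X T) (m x) ≠ d x (gadgetIndex T x)

/-- The tape that starts with the bits of `t`, followed by zeros. -/
def tapeOfPrefix {K : ℕ} (t : Fin K → Bool) (i : ℕ) : Bool := if h : i < K then t ⟨i, h⟩ else false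

lemma gadgetIndex_eq_iff {S T : Finset HalfRat} {x : HalfRat} :
    gadgetIndex S x = gadgetIndex T x ↔ (x ∈ S ↔ x ∈ T) := by
  unfold gadgetIndex
  by_cases h1 : x ∈ S <;> by_cases h2 : x ∈ T <;> simp [h1, h2]

/-- The items that arrive before `m x` come from gadgets whose first item arrives before `m x`. -/
lemma gadgetUnion_filter_subset {P : U → ℝ} {G : HalfRat → Fin 2 → Finset U} {m : HalfRat → U}
    (hfirst : ∀ x i, IsFirstItem P (G x i) (m x)) {X S T : Finset HalfRat} {x : HalfRat}
    (h : ∀ y ∈ X, P (m x) < P (m y) → gadgetIndex S y = gadgetIndex T y) :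
    (gadgetUnion G X S).filter (fun v => P (m x) < P v) ⊆
      (gadgetUnion G X T).filter (fun v => P (m x) < P v) := by
  intro v hv
  obtain ⟨hv, hlt⟩ := Finset.mem_filter.1 hv
  obtain ⟨y, hy, hvy⟩ := Finset.mem_biUnion.1 hv
  refine Finset.mem_filter.2 ⟨Finset.mem_biUnion.2 ⟨y, hy, ?_⟩, hlt⟩
  rwa [← h y hy (hlt.trans_le ((hfirst y _).2 v hvy))]

/-- For a fixed tape the choice of the gadgets can be recovered from the set of wrong answers. -/
lemma wrongAnswers_injOn {A : PriorityAlgorithm U} {G : HalfRat → Fin 2 → Finset U}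
    {m : HalfRat → U} {d : HalfRat → Fin 2 → Bool}
    (hfirst : ∀ x i, IsFirstItem A.prio (G x i) (m x)) (hd : ∀ x, d x 0 ≠ d x 1)
    (X : Finset HalfRat) (φ : ℕ → Bool) :
    Set.InjOn (wrongAnswers A G m d X φ) X.powerset := by
  intro S hS T hT heq
  have hS := Finset.mem_powerset.1 (Finset.mem_coe.1 hS)
  have hT := Finset.mem_powerset.1 (Finset.mem_coe.1 hT)
  by_contra hne
  have hD : (X.filter fun x => ¬(x ∈ S ↔ x ∈ T)).Nonempty := by
    by_contra hem
    rw [Finset.not_nonempty_iff_eq_empty, Finset.filter_eq_empty_iff] at hem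
    refine hne (Finset.ext fun x => ?_)
    by_cases hx : x ∈ X
    · exact not_not.1 (hem hx)
    · exact ⟨fun h => absurd (hS h) hx, fun h => absurd (hT h) hx⟩
  -- The earliest first item at which the two choices differ. The items before it coincide, hence so
  -- do the answers, but the correct decisions are opposite: `x` lies in exactly one of the two sets
  -- of wrong answers.
  obtain ⟨x, hx, hmax⟩ := Finset.exists_max_image _ (fun x => A.prio (m x)) hD
  obtain ⟨hxX, hxST⟩ := Finset.mem_filter.1 hx
  have hagree : ∀ y ∈ X, A.prio (m x) < A.prio (m y) → gadgetIndex S y = gadgetIndex T y := by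
    intro y hy hlt
    rw [gadgetIndex_eq_iff]
    by_contra hyST
    exact absurd (hmax y (Finset.mem_filter.2 ⟨hy, hyST⟩)) (not_le.2 hlt)
  have hans : A.answer φ (gadgetUnion G X S) (m x) = A.answer φ (gadgetUnion G X T) (m x) := by
    unfold PriorityAlgorithm.answer
    rw [(gadgetUnion_filter_subset hfirst hagree).antisymm
      (gadgetUnion_filter_subset hfirst fun y hy h => (hagree y hy h).symm)]
  have hdec : d x (gadgetIndex S x) ≠ d x (gadgetIndex T x) := by
    unfold gadgetIndex
    by_cases h1 : x ∈ S <;> by_cases h2 : x ∈ T <;> simp [h1, h2] at hxST ⊢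
    · exact (hd x).symm
    · exact hd x
  have hmem := Finset.ext_iff.1 heq x
  simp only [wrongAnswers, Finset.mem_filter, hxX, true_and, hans] at hmem
  revert hmem hdec
  generalize A.answer φ (gadgetUnion G X T) (m x) = a
  generalize d x (gadgetIndex S x) = b
  generalize d x (gadgetIndex T x) = c
  revert a b c
  decide

variable {B : MinProblem U} {A : PriorityAlgorithm U} {G : HalfRat → Fin 2 → Finset U}
  {m : HalfRat → U} {s : ℕ} {O D : Fin 2 → ℝ≥0∞}

/-! ### Costs and advice on unions of gadgets. -/

namespace IsGadgetFamily

lemma exists_decision (hG : IsGadgetFamily B A.prio G m s O D) :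
    ∃ d : HalfRat → Fin 2 → Bool, (∀ x, d x 0 ≠ d x 1) ∧
      ∀ x i, B.OptimalDecision (G x i) (m x) (d x i) := by
  choose a b hab ha hb using hG.distinguishing
  refine ⟨fun x => ![a x, b x], fun x => by simpa using hab x, fun x i => ?_⟩
  fin_cases i
  · exact ha x
  · exact hb x

lemma opt_gadgetUnion (hG : IsGadgetFamily B A.prio G m s O D) (hB : B.IsAdditive)
    {X : Finset HalfRat} (hX : X.Nonempty) (T : Finset HalfRat) :
    B.opt (gadgetUnion G X T) = ∑ x ∈ X, O (gadgetIndex T x) := by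
  refine ((hB.biUnion (fun x => G x (gadgetIndex T x))
    (fun x y h => hG.disjoint_copies x y h _ _) (fun X hX => hG.isInstance X _ hX) X hX).1).trans ?_
  exact Finset.sum_congr rfl fun x _ => hG.opt_eq x _

/-- Each wrong answer costs at least `δ`. -/
lemma opt_add_le_algCost (hG : IsGadgetFamily B A.prio G m s O D) (hB : B.IsAdditive)
    {d : HalfRat → Fin 2 → Bool} (hd : ∀ x i, B.OptimalDecision (G x i) (m x) (d x i))
    {δ : ℝ≥0∞} (hδ : ∀ i, O i + δ ≤ D i) {X : Finset HalfRat} (hX : X.Nonempty)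
    (T : Finset HalfRat) :
    B.opt (gadgetUnion G X T) +
        #(wrongAnswers A G m d X (A.oracle (gadgetUnion G X T)) T) * δ ≤
      A.algCost B (gadgetUnion G X T) := by
  set I := gadgetUnion G X T with hI
  have hcost := (hB.biUnion (fun x => G x (gadgetIndex T x))
    (fun x y h => hG.disjoint_copies x y h _ _) (fun X hX => hG.isInstance X _ hX) X hX).2
    (A.accepted I) (Finset.filter_subset _ _)
  refine le_trans ?_ hcost
  rw [hI, hG.opt_gadgetUnion hB hX, ← nsmul_eq_mul, ← Finset.sum_const, wrongAnswers,
    Finset.sum_filter, ← Finset.sum_add_distrib]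
  refine Finset.sum_le_sum fun x hx => ?_
  split_ifs with hw
  · refine (hδ _).trans ?_
    rw [← hG.bad_eq x]
    refine (hd x _).bad_le_cost Finset.inter_subset_right fun hiff => hw ?_
    have hm := (hG.first_item x (gadgetIndex T x)).1
    have hmI : m x ∈ gadgetUnion G X T := Finset.mem_biUnion.2 ⟨x, hx, hm⟩
    rw [Finset.mem_inter, PriorityAlgorithm.accepted, Finset.mem_filter] at hiff
    simp only [hm, hmI, and_true, true_and] at hiff
    exact Bool.eq_iff_iff.2 hiff
  · rw [add_zero, ← hG.opt_eq x]
    exact B.opt_le_cost Finset.inter_subset_right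

/-- Makes the instances grow with `#X`, since the advice bound holds only for large instances. -/
lemma card_le_card_gadgetUnion (hG : IsGadgetFamily B A.prio G m s O D) (X T : Finset HalfRat) :
    #X ≤ #(gadgetUnion G X T) := by
  refine Finset.card_le_card_of_injOn m (fun x hx => ?_) fun x _ y _ hxy => ?_
  · exact Finset.mem_biUnion.2 ⟨x, hx, (hG.first_item x _).1⟩
  · by_contra hne
    exact Finset.disjoint_left.1 (hG.disjoint_copies x y hne 0 0) (hG.first_item x 0).1
      (hxy ▸ (hG.first_item y 0).1)

lemma card_gadgetUnion_le (hG : IsGadgetFamily B A.prio G m s O D) (X T : Finset HalfRat) :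
    #(gadgetUnion G X T) ≤ #X * s :=
  Finset.card_biUnion_le_card_mul _ _ _ fun x _ => hG.size x _

/-- For all large `N` there are `N` gadgets on which at least `ε N` answers are wrong and at least
`ε N` gadgets are of the first kind. -/
lemma eventually_exists_wrongAnswers (hG : IsGadgetFamily B A.prio G m s O D)
    {d : HalfRat → Fin 2 → Bool} (hd : ∀ x, d x 0 ≠ d x 1)
    {ε : ℝ} (hε : ε ∈ Set.Ioo (0 : ℝ) (1 / 2))
    (hA : A.ReadsFewerThan B (fun n => (1 - entropyTwo ε) * n / (2 * s))) :
    ∀ᶠ N : ℕ in Filter.atTop, ∃ X T : Finset HalfRat, X.Nonempty ∧ #X = N ∧ T ⊆ X ∧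
      ε * N < #(wrongAnswers A G m d X (A.oracle (gadgetUnion G X T)) T) ∧
      ε * N < #(X \ T) := by
  have hη : 0 < 1 - entropyTwo ε := sub_pos.2 (entropyTwo_lt_one hε)
  have : Infinite HalfRat := (Set.Icc_infinite (by norm_num)).to_subtype
  have hs : 0 < s := by
    have x : HalfRat := ⟨0, by norm_num⟩
    exact (Finset.card_pos.2 ⟨_, (hG.first_item x 0).1⟩).trans_le (hG.size x 0)
  obtain ⟨n₀, hn₀⟩ := Filter.eventually_atTop.1 hA
  -- Ensures `K + 1 < (1 - H(ε)) N` for the `K` below, hence `2 ^ K + 1 ≤ 2 ^ (K + 1) < 2 ^ ((1 -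
  -- H(ε)) N)`.
  have hlarge : ∀ᶠ N : ℕ in Filter.atTop, 2 / (1 - entropyTwo ε) < N :=
    tendsto_natCast_atTop_atTop.eventually_gt_atTop _
  filter_upwards [Filter.eventually_ge_atTop n₀, Filter.eventually_gt_atTop 0, hlarge]
    with N hN hN0 hN2
  obtain ⟨X, rfl⟩ := Infinite.exists_subset_card_eq HalfRat N
  have hX : X.Nonempty := Finset.card_pos.1 hN0
  set K := ⌊(1 - entropyTwo ε) * #X / 2⌋₊ with hK
  have hKle : (K : ℝ) ≤ (1 - entropyTwo ε) * #X / 2 := Nat.floor_le (by positivity)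
  rw [div_lt_iff₀ hη] at hN2
  have hcount : (Fintype.card (Fin K → Bool) : ℝ) + 1 < 2 ^ ((1 - entropyTwo ε) * #X) := by
    have h1 : (1 : ℝ) ≤ 2 ^ K := one_le_pow₀ one_le_two
    have h2 : (2 : ℝ) ^ (K + 1) < 2 ^ ((1 - entropyTwo ε) * #X) := by
      rw [← Real.rpow_natCast]
      refine Real.rpow_lt_rpow_of_exponent_lt one_lt_two ?_
      push_cast
      linarith
    simp only [Fintype.card_pi, Fintype.card_bool, Finset.prod_const, Finset.card_univ,
      Fintype.card_fin, Nat.cast_pow, Nat.cast_ofNat]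
    rw [pow_succ] at h2
    linarith
  obtain ⟨T, hTX, hcode, hcompl⟩ := exists_subset_large_code X hε
    (fun t => wrongAnswers A G m d X (tapeOfPrefix t)) (fun t T => Finset.filter_subset _ _)
    (fun t => wrongAnswers_injOn hG.first_item hd X (tapeOfPrefix t)) hcount
  refine ⟨X, T, hX, rfl, hTX, ?_, hcompl⟩
  set I := gadgetUnion G X T with hI
  obtain ⟨k, hk, hread⟩ := hn₀ #I (hN.trans (hG.card_le_card_gadgetUnion X T)) I
    (hG.isInstance X _ hX) rfl
  have hkK : k ≤ K := by
    refine Nat.le_floor (hk.le.trans ?_)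
    have hcard : (#I : ℝ) ≤ #X * s := by exact_mod_cast hG.card_gadgetUnion_le X T
    rw [div_le_div_iff₀ (by positivity) two_pos]
    nlinarith [mul_le_mul_of_nonneg_left hcard hη.le]
  -- At most `K` bits are read, so cutting the oracle's tape after `K` bits changes no answer.
  have heq : wrongAnswers A G m d X (tapeOfPrefix fun i : Fin K => A.oracle I i) T =
      wrongAnswers A G m d X (A.oracle I) T := by
    refine Finset.filter_congr fun x hx => ?_
    rw [← hI, hread (tapeOfPrefix fun i : Fin K => A.oracle I i) (fun i hi => ?_) (m x)
      (Finset.mem_biUnion.2 ⟨x, hx, (hG.first_item x _).1⟩)]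
    simp [tapeOfPrefix, hi.trans_le hkK]
  rw [← heq]
  exact hcode _

lemma opt_ne_top (hG : IsGadgetFamily B A.prio G m s O D) (i : Fin 2) : O i ≠ ⊤ := by
  obtain ⟨d, -, hd⟩ := hG.exists_decision
  have x : HalfRat := ⟨0, by norm_num⟩
  rw [← hG.opt_eq x i]
  exact (hd x i).opt_ne_top (hG.first_item x i).1

lemma opt_lt_bad (hG : IsGadgetFamily B A.prio G m s O D) (i : Fin 2) : O i < D i := by
  obtain ⟨d, -, hd⟩ := hG.exists_decision
  have x : HalfRat := ⟨0, by norm_num⟩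
  rw [← hG.opt_eq x i, ← hG.bad_eq x i]
  exact (hd x i).opt_lt_bad (hG.first_item x i).1

/-- As second gadgets are at least as expensive, the extreme case is a share of exactly `ε` of first
gadgets. -/
lemma toReal_opt_gadgetUnion_le (hG : IsGadgetFamily B A.prio G m s O D) (hB : B.IsAdditive)
    {X T : Finset HalfRat} (hX : X.Nonempty) (hTX : T ⊆ X) {ε : ℝ} (hT : ε * #X ≤ #(X \ T)) :
    (B.opt (gadgetUnion G X T)).toReal ≤
      #X * (ε * (O 0).toReal + (1 - ε) * (O 1).toReal) := by
  have hle : (O 0).toReal ≤ (O 1).toReal := ENNReal.toReal_mono (hG.opt_ne_top 1) hG.opt_le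
  have hsum : ∑ x ∈ X, (O (gadgetIndex T x)).toReal =
      #(X \ T) * (O 0).toReal + #T * (O 1).toReal := by
    rw [← Finset.sum_sdiff hTX]
    congr 1
    · rw [← nsmul_eq_mul, ← Finset.sum_const]
      refine Finset.sum_congr rfl fun x hx => ?_
      rw [gadgetIndex, if_neg (Finset.mem_sdiff.1 hx).2]
    · rw [← nsmul_eq_mul, ← Finset.sum_const]
      refine Finset.sum_congr rfl fun x hx => ?_
      rw [gadgetIndex, if_pos hx]
  have hcard : (#T : ℝ) = #X - #(X \ T) := by
    rw [eq_sub_iff_add_eq', ← Nat.cast_add, Finset.card_sdiff_add_card_eq_card hTX]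
  rw [hG.opt_gadgetUnion hB hX, ENNReal.toReal_sum fun x _ => hG.opt_ne_top _, hsum, hcard]
  nlinarith [mul_nonneg (sub_nonneg.2 hT) (sub_nonneg.2 hle)]

/-- A bound on every approximation factor, in terms of the least cost `δ` of a wrong answer. -/
lemma mul_le_of_isApprox (hG : IsGadgetFamily B A.prio G m s O D) (hB : B.IsAdditive)
    {ε : ℝ} (hε : ε ∈ Set.Ioo (0 : ℝ) (1 / 2))
    (hA : A.ReadsFewerThan B (fun n => (1 - entropyTwo ε) * n / (2 * s)))
    {δ : ℝ≥0∞} (hδ0 : δ ≠ 0) (hδ : ∀ i, O i + δ ≤ D i) {c : ℝ≥0} (hc : A.IsApprox B c) :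
    δ ≠ ⊤ ∧ 1 < c ∧
      ε * δ.toReal ≤ (c - 1) * (ε * (O 0).toReal + (1 - ε) * (O 1).toReal) := by
  obtain ⟨d, hd, hopt⟩ := hG.exists_decision
  obtain ⟨α, hα⟩ := hc
  set Q := ε * (O 0).toReal + (1 - ε) * (O 1).toReal with hQ
  have hQ0 : 0 ≤ Q := by
    have h1 : 0 ≤ 1 - ε := by linarith [hε.2]
    have := hε.1
    positivity
  have hev := hG.eventually_exists_wrongAnswers hd hε hA
  -- The case `c < 1` is not yet excluded; the maximum keeps the factor nonnegative, so that `OPT`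
  -- can be replaced by its upper bound.
  have hevent : ∀ᶠ N : ℕ in Filter.atTop, δ ≠ ⊤ ∧
      N * (ε * δ.toReal) ≤ N * (max (c - 1 : ℝ) 0 * Q) + α := by
    filter_upwards [hev] with N ⟨X, T, hX, hXN, hTX, hw, hT⟩
    have hle := (hG.opt_add_le_algCost hB hopt hδ hX T).trans (hα _ (hG.isInstance X _ hX))
    change B.opt (gadgetUnion G X T) + _ ≤ c * B.opt (gadgetUnion G X T) + α at hle
    have hopt_le := hG.toReal_opt_gadgetUnion_le hB hX hTX (hXN ▸ hT.le)
    have hfin : B.opt (gadgetUnion G X T) ≠ ⊤ := by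
      rw [hG.opt_gadgetUnion hB hX]
      exact ENNReal.sum_ne_top.2 fun x _ => hG.opt_ne_top _
    have hR : (c : ℝ≥0∞) * B.opt (gadgetUnion G X T) + α ≠ ⊤ :=
      ENNReal.add_ne_top.2 ⟨ENNReal.mul_ne_top ENNReal.coe_ne_top hfin, ENNReal.coe_ne_top⟩
    have hL := ne_top_of_le_ne_top hR hle
    have hwpos : (0 : ℝ) < #(wrongAnswers A G m d X (A.oracle (gadgetUnion G X T)) T) :=
      lt_of_le_of_lt (mul_nonneg hε.1.le N.cast_nonneg) hw
    have hδtop : δ ≠ ⊤ := by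
      rintro rfl
      refine (ENNReal.add_ne_top.1 hL).2 (ENNReal.mul_top ?_)
      exact_mod_cast hwpos.ne'
    refine ⟨hδtop, ?_⟩
    have hreal := ENNReal.toReal_mono hR hle
    rw [ENNReal.toReal_add hfin (ENNReal.add_ne_top.1 hL).2,
      ENNReal.toReal_add (ENNReal.add_ne_top.1 hR).1 ENNReal.coe_ne_top, ENNReal.toReal_mul,
      ENNReal.toReal_mul, ENNReal.toReal_natCast, ENNReal.coe_toReal, ENNReal.coe_toReal] at hreal
    rw [hXN, ← hQ] at hopt_le
    have h1 := mul_le_mul_of_nonneg_right hw.le (ENNReal.toReal_nonneg (a := δ))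
    have h2 : ((c : ℝ) - 1) * (B.opt (gadgetUnion G X T)).toReal ≤
        max (c - 1 : ℝ) 0 * (N * Q) :=
      mul_le_mul (le_max_left _ _) hopt_le ENNReal.toReal_nonneg (le_max_right _ _)
    linarith
  have hδtop : δ ≠ ⊤ := hevent.exists.choose_spec.1
  -- Dividing by `N` and letting `N → ∞` removes `α`.
  have hlim : ε * δ.toReal ≤ max (c - 1 : ℝ) 0 * Q := by
    by_contra! hlt
    obtain ⟨N, ⟨-, hN⟩, hN'⟩ := (hevent.and (tendsto_natCast_atTop_atTop.eventually_gt_atTop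
      ((α : ℝ) / (ε * δ.toReal - max (c - 1 : ℝ) 0 * Q)))).exists
    rw [div_lt_iff₀ (sub_pos.2 hlt)] at hN'
    linarith
  have hpos : 0 < ε * δ.toReal := mul_pos hε.1 (ENNReal.toReal_pos hδ0 hδtop)
  have hc1 : (0 : ℝ) < c - 1 := by
    by_contra! h
    rw [max_eq_right h, zero_mul] at hlim
    linarith
  rw [max_eq_left hc1.le] at hlim
  exact ⟨hδtop, by exact_mod_cast sub_pos.1 hc1, hlim⟩

end IsGadgetFamily

end Gadgets

/-! ### From the additive loss `δ` to the ratio `r`. -/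

theorem mainTheorem2 {U : Type*} [DecidableEq U] (B : MinProblem U) (hB : B.IsAdditive)
    (A : PriorityAlgorithm U)
    (G : HalfRat → Fin 2 → Finset U) (m : HalfRat → U) (s : ℕ) (O D : Fin 2 → ℝ≥0∞)
    (hG : IsGadgetFamily B A.prio G m s O D)
    (r : ℝ≥0∞) (hr : r = min (D 0 / O 0) (D 1 / O 1))
    (ε : ℝ) (hε : ε ∈ Set.Ioo (0 : ℝ) (1 / 2))
    (hA : A.ReadsFewerThan B (fun n => (1 - entropyTwo ε) * n / (2 * s))) :
    1 + ENNReal.ofReal ε * (r - 1) * O 0 /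
        (ENNReal.ofReal ε * O 0 + ENNReal.ofReal (1 - ε) * O 1) ≤ A.approxRatio B := by
  refine le_iInf₂ fun c hc => ?_
  set δ := min (D 0 - O 0) (D 1 - O 1) with hδ
  have hδ0 : δ ≠ 0 :=
    (lt_min (tsub_pos_of_lt (hG.opt_lt_bad 0)) (tsub_pos_of_lt (hG.opt_lt_bad 1))).ne'
  have hδle : ∀ i, δ ≤ D i - O i := by
    rw [Fin.forall_fin_two]
    exact ⟨min_le_left _ _, min_le_right _ _⟩
  have hδadd : ∀ i, O i + δ ≤ D i := fun i =>
    (add_le_add_right (hδle i) (O i)).trans (add_tsub_cancel_of_le (hG.opt_lt_bad i).le).le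
  obtain ⟨hδtop, hc1, hbound⟩ := hG.mul_le_of_isApprox hB hε hA hδ0 hδadd hc
  have hrle : ∀ i, r ≤ D i / O i := by
    rw [Fin.forall_fin_two, hr]
    exact ⟨min_le_left _ _, min_le_right _ _⟩
  have hOle : ∀ i, O 0 ≤ O i := by
    rw [Fin.forall_fin_two]
    exact ⟨le_rfl, hG.opt_le⟩
  -- `OPT(G^1) ≤ OPT(G^2)` allows the same lower bound for both differences, hence for `δ`.
  have hrδ : ∀ i, (r - 1) * O 0 ≤ D i - O i := fun i =>
    calc (r - 1) * O 0 ≤ (r - 1) * O i := by gcongr; exact hOle i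
      _ = r * O i - O i := by
        rw [ENNReal.sub_mul fun _ _ => hG.opt_ne_top i, one_mul]
      _ ≤ D i - O i := tsub_le_tsub_right (ENNReal.mul_le_of_le_div (hrle i)) _
  have h1ε : 0 ≤ 1 - ε := by linarith [hε.2]
  set Q := ENNReal.ofReal ε * O 0 + ENNReal.ofReal (1 - ε) * O 1 with hQ
  have hkey : ENNReal.ofReal ε * (r - 1) * O 0 ≤ (c - 1 : ℝ≥0∞) * Q := by
    rw [mul_assoc]
    refine (mul_le_mul_right (le_min (hrδ 0) (hrδ 1)) _).trans ?_
    rw [← hδ, ← ENNReal.ofReal_toReal hδtop, ← ENNReal.ofReal_mul hε.1.le]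
    refine (ENNReal.ofReal_le_ofReal hbound).trans_eq ?_
    have hc' : (0 : ℝ) ≤ c - 1 := sub_nonneg.2 (by exact_mod_cast hc1.le)
    have := hε.1.le
    rw [ENNReal.ofReal_mul hc', ENNReal.ofReal_add (by positivity) (by positivity),
      ENNReal.ofReal_mul hε.1.le, ENNReal.ofReal_mul h1ε, ENNReal.ofReal_toReal (hG.opt_ne_top 0),
      ENNReal.ofReal_toReal (hG.opt_ne_top 1), ENNReal.ofReal_sub _ zero_le_one,
      ENNReal.ofReal_coe_nnreal, ENNReal.ofReal_one]
  calc 1 + ENNReal.ofReal ε * (r - 1) * O 0 / Q ≤ 1 + (c - 1) :=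
        add_le_add_right (ENNReal.div_le_of_le_mul hkey) 1
    _ = c := add_tsub_cancel_of_le (by exact_mod_cast hc1.le)
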